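/- Let $N\ge 1$, $\alpha\in(0,2]$ and $1<p\le 1+\alpha/N$, and let $u_0\in L^1(\mathbb{R}^N)$ be nonnegative. Let $\Lambda^\alpha=(-\Delta)^{\alpha/2}$ be the operator with Fourier symbol $|\xi|^\alpha$, and let $u=u(x,t)\ge 0$ be a nonnegative weak solution on $\mathbb{R}^N\times(0,\infty)$ of $$\partial_t u=-\Lambda^\alpha u-u^p,\qquad u(x,0)=u_0(x).$$ Weak solution means: for every $T>0$, $u(\cdot,T)\in L^1(\mathbb{R}^N)$, $u\in L^1(\mathbb{R}^N\times(0,T))$, $u^p\in L^1(K\times(0,T))$ for every compact $K\subset\mathbb{R}^N$, and for every real $\varphi\in C_c^\infty(\mathbb{R}^N\times\mathbb{R})$ $$\int_{\mathbb{R}^N}u(x,T)\varphi(x,T)\,dx-\int_{\mathbb{R}^N}u_0(x)\varphi(x,0)\,dx=\int_0^T\!\!\int_{\mathbb{R}^N}u\,(\partial_t\varphi-\Lambda^\alpha\varphi)\,dx\,dt-\int_0^T\!\!\int_{\mathbb{R}^N}u^p\varphi\,dx\,dt .$$ Then the mass $M(t)=\int_{\mathbb{R}^N}u(x,t)\,dx$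 satisfies $\lim_{t\to\infty}M(t)=0$. -/

import Mathlib

open MeasureTheory Set Filter Topology
open scoped FourierTransform ContDiff

noncomputable section

/-- The fractional Laplacian `Λ^α f = (-Δ)^{α/2} f` of a real function on `ℝ^N`, defined by the
Fourier multiplier `|ξ|^α`. Mathlib's transform has the kernel `exp (-2πi⟨x, ξ⟩)`, so that the
frequency variable is `2πξ` and the multiplier reads `(2π‖ξ‖)^α`. -/
def fracLaplacian {N : ℕ} (α : ℝ) (f : EuclideanSpace ℝ (Fin N) → ℝ)
    (x : EuclideanSpace ℝ (Fin N)) : ℝ :=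
  (𝓕⁻ (fun ξ : EuclideanSpace ℝ (Fin N) =>
    (((2 * Real.pi * ‖ξ‖) ^ α : ℝ) : ℂ) *
      𝓕 (fun y : EuclideanSpace ℝ (Fin N) => (f y : ℂ)) ξ) x).re

/-- `u` (written `u t x`) is a nonnegative weak solution, global in time, of
`∂ₜ u = -Λ^α u - u^p` on `ℝ^N × (0, ∞)`, `u(·, 0) = u₀`, with finite mass:
`u` belongs to `L¹(ℝ^N × (0, T))` for every `T`, `u(t) ∈ L¹(ℝ^N)` for every `t > 0`,
`u^p` is locally integrable up to time `0`, and the equation and the initial condition hold after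
multiplication by a smooth compactly supported `φ(t, x)` and integration over
`ℝ^N × (0, T)`, for every `T > 0`. -/
structure IsNonnegWeakSolution {N : ℕ} (α p : ℝ) (u₀ : EuclideanSpace ℝ (Fin N) → ℝ)
    (u : ℝ → EuclideanSpace ℝ (Fin N) → ℝ) : Prop where
  nonneg : ∀ t : ℝ, 0 < t → ∀ᵐ x, 0 ≤ u t x
  integrable_slice : ∀ t : ℝ, 0 < t → Integrable (u t)
  integrable : ∀ T : ℝ, 0 < T →
    IntegrableOn (fun z : ℝ × EuclideanSpace ℝ (Fin N) => u z.1 z.2) (Ioc 0 T ×ˢ univ)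
  integrable_pow : ∀ T : ℝ, 0 < T → ∀ K : Set (EuclideanSpace ℝ (Fin N)), IsCompact K →
    IntegrableOn (fun z : ℝ × EuclideanSpace ℝ (Fin N) => u z.1 z.2 ^ p) (Ioc 0 T ×ˢ K)
  weak_eq : ∀ φ : ℝ × EuclideanSpace ℝ (Fin N) → ℝ, ContDiff ℝ ∞ φ → HasCompactSupport φ →
    ∀ T : ℝ, 0 < T →
      (∫ x, u T x * φ (T, x)) - ∫ x, u₀ x * φ (0, x) =
        (∫ z in Ioc 0 T ×ˢ (univ : Set (EuclideanSpace ℝ (Fin N))),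
          u z.1 z.2 * (deriv (fun s => φ (s, z.2)) z.1
            - fracLaplacian α (fun y => φ (z.1, y)) z.2))
        - ∫ z in Ioc 0 T ×ˢ (univ : Set (EuclideanSpace ℝ (Fin N))),
          u z.1 z.2 ^ p * φ z

end

/-! ### Scaling of the fractional Laplacian under dilation. -/

section FractionalLaplacian

variable {N : ℕ}

/-! Testing the equation with `χ(x/ρ)` costs at most `C ρ^(-α) ∫∫ u`, since `Λ^α` of a dilated bump
is uniformly `O(ρ^(-α))`. As `ρ → ∞` this gives `M(T) + ∫∫ u^p = M(0)` (`mass_balance`): `M`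
decreases and the total absorption is finite.

Suppose `M ≥ ε` forever. The same estimate at `ρ = B t^(1/α)` shows that mass spreads no faster than
this radius, so `ε/2` remains in a region of volume of order `t^(N/α)` (`exists_localized_mass_ge`).
Convexity of the power then forces `∫ u^p ≥ c t^(-N(p-1)/α) ≥ c/t` for large `t`
(`exists_absorption_ge`), because `N(p-1) ≤ α`. Since `1/t` is not integrable at infinity, the
absorption would be infinite. No heat kernel or comparison principle is needed. -/

theorem abs_fracLaplacian_le (α : ℝ) (f : EuclideanSpace ℝ (Fin N) → ℝ)
    (x : EuclideanSpace ℝ (Fin N)) :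
    |fracLaplacian α f x| ≤
      ∫ ξ, ‖(((2 * Real.pi * ‖ξ‖) ^ α : ℝ) : ℂ) *
        𝓕 (fun y : EuclideanSpace ℝ (Fin N) => (f y : ℂ)) ξ‖ :=
  (Complex.abs_re_le_norm _).trans
    (VectorFourier.norm_fourierIntegral_le_integral_norm _ _ _ _ _)

theorem fourier_comp_inv_smul (f : EuclideanSpace ℝ (Fin N) → ℂ) {ρ : ℝ} (hρ : 0 < ρ)
    (ξ : EuclideanSpace ℝ (Fin N)) :
    𝓕 (fun y => f (ρ⁻¹ • y)) ξ = ((ρ ^ N : ℝ) : ℂ) * 𝓕 f (ρ • ξ) := by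
  have h := Measure.integral_comp_inv_smul_of_nonneg
    (volume : Measure (EuclideanSpace ℝ (Fin N)))
    (fun z => Real.fourierChar (-(inner ℝ z (ρ • ξ))) • f z) hρ.le
  rw [finrank_euclideanSpace_fin, Complex.real_smul] at h
  rw [Real.fourier_eq, Real.fourier_eq, ← h]
  congr 1
  ext y
  rw [real_inner_smul_left, real_inner_smul_right, inv_mul_cancel_left₀ hρ.ne']

/-- The multiplier `|ξ|^α` scales like a derivative of order `α`. The constant is the `L¹` norm of
`(2π‖ξ‖)^α 𝓕 f`, finite for `f` smooth with compact support, the case of interest. -/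
theorem exists_abs_fracLaplacian_comp_inv_smul_le (α : ℝ) (f : EuclideanSpace ℝ (Fin N) → ℝ) :
    ∃ C : ℝ, 0 ≤ C ∧ ∀ ρ : ℝ, 0 < ρ → ∀ x,
      |fracLaplacian α (fun y => f (ρ⁻¹ • y)) x| ≤ C * ρ ^ (-α) := by
  set G : EuclideanSpace ℝ (Fin N) → ℝ := fun ξ =>
    ‖(((2 * Real.pi * ‖ξ‖) ^ α : ℝ) : ℂ) *
        𝓕 (fun y : EuclideanSpace ℝ (Fin N) => (f y : ℂ)) ξ‖ with hG
  refine ⟨∫ ξ, G ξ, integral_nonneg fun _ => norm_nonneg _, fun ρ hρ x => ?_⟩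
  refine (abs_fracLaplacian_le α _ x).trans_eq ?_
  have hpt : ∀ ξ : EuclideanSpace ℝ (Fin N),
      ‖(((2 * Real.pi * ‖ξ‖) ^ α : ℝ) : ℂ) *
        𝓕 (fun y : EuclideanSpace ℝ (Fin N) => ((f (ρ⁻¹ • y) : ℝ) : ℂ)) ξ‖
        = (ρ ^ N * ρ ^ (-α)) * G (ρ • ξ) := by
    intro ξ
    rw [fourier_comp_inv_smul (fun y => (f y : ℂ)) hρ]
    simp only [hG, norm_mul, Complex.norm_real, Real.norm_eq_abs, norm_smul]
    rw [abs_of_pos hρ, abs_of_pos (pow_pos hρ N),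
      show 2 * Real.pi * (ρ * ‖ξ‖) = ρ * (2 * Real.pi * ‖ξ‖) by ring,
      Real.mul_rpow hρ.le (by positivity), abs_mul, abs_of_pos (Real.rpow_pos_of_pos hρ α),
      Real.rpow_neg hρ.le]
    have := (Real.rpow_pos_of_pos hρ α).ne'
    field_simp
  -- The Jacobian `ρ^(-N)` of `ξ ↦ ρ • ξ` cancels the `ρ^N` from the transform; only `ρ^(-α)`
  -- survives.
  simp_rw [hpt]
  rw [integral_const_mul, Measure.integral_comp_smul_of_nonneg _ _ _ (hR := hρ.le),
    finrank_euclideanSpace_fin, smul_eq_mul]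
  have := (pow_pos hρ N).ne'
  field_simp

end FractionalLaplacian

/-! ### Dilated cutoffs and a substitute for Hölder's inequality. -/

section Cutoff

variable {E : Type*} [NormedAddCommGroup E] [InnerProductSpace ℝ E]

/-- A smooth bump on `E`, equal to `1` on the unit ball and supported in the ball of radius `2`. -/
def unitBump (E : Type*) [NormedAddCommGroup E] [InnerProductSpace ℝ E] :
    ContDiffBump (0 : E) where
  rIn := 1
  rOut := 2
  rIn_pos := one_pos
  rIn_lt_rOut := one_lt_two

/-- The dilated bump `x ↦ χ (x / ρ)`, equal to `1` on the ball of radius `ρ`. -/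
noncomputable def dilatedBump (ρ : ℝ) (x : E) : ℝ := unitBump E (ρ⁻¹ • x)

theorem dilatedBump_nonneg (ρ : ℝ) (x : E) : 0 ≤ dilatedBump ρ x := (unitBump E).nonneg

theorem dilatedBump_le_one (ρ : ℝ) (x : E) : dilatedBump ρ x ≤ 1 := (unitBump E).le_one

theorem dilatedBump_eq_one {ρ : ℝ} (hρ : 0 < ρ) {x : E} (hx : ‖x‖ ≤ ρ) :
    dilatedBump ρ x = 1 := by
  refine (unitBump E).one_of_mem_closedBall ?_
  rw [mem_closedBall_zero_iff, norm_smul, norm_inv, Real.norm_of_nonneg hρ.le]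
  exact (inv_mul_le_one₀ hρ).2 hx

theorem dilatedBump_eq_zero {ρ : ℝ} (hρ : 0 < ρ) {x : E} (hx : 2 * ρ ≤ ‖x‖) :
    dilatedBump ρ x = 0 := by
  refine (unitBump E).zero_of_le_dist ?_
  rw [dist_zero_right, norm_smul, norm_inv, Real.norm_of_nonneg hρ.le]
  exact (le_inv_mul_iff₀ hρ).2 (by simpa [unitBump, mul_comm] using hx)

theorem tendsto_dilatedBump (x : E) :
    Tendsto (fun ρ : ℝ => dilatedBump ρ x) atTop (𝓝 1) := by
  refine tendsto_const_nhds.congr' ?_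
  filter_upwards [eventually_ge_atTop ‖x‖, eventually_gt_atTop 0] with ρ h h'
  exact (dilatedBump_eq_one h' h).symm

variable [FiniteDimensional ℝ E]

theorem contDiff_dilatedBump (ρ : ℝ) : ContDiff ℝ ∞ (dilatedBump ρ : E → ℝ) :=
  (unitBump E).contDiff.comp (contDiff_const_smul _)

theorem hasCompactSupport_dilatedBump {ρ : ℝ} (hρ : 0 < ρ) :
    HasCompactSupport (dilatedBump ρ : E → ℝ) :=
  HasCompactSupport.intro (isCompact_closedBall (0 : E) (2 * ρ)) fun x hx => by
    rw [mem_closedBall_zero_iff, not_le] at hx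
    exact dilatedBump_eq_zero hρ hx.le

variable [MeasurableSpace E] [BorelSpace E]

theorem integrable_mul_dilatedBump {X : Type*} [MeasurableSpace X] {μ : Measure X} {f : X → ℝ}
    (hf : Integrable f μ) {π : X → E} (hπ : Measurable π) (ρ : ℝ) :
    Integrable (fun x => f x * dilatedBump ρ (π x)) μ := by
  refine hf.mul_bdd (c := 1)
    ((contDiff_dilatedBump ρ).continuous.measurable.comp hπ).aestronglyMeasurable
    (Eventually.of_forall fun x => ?_)
  rw [Real.norm_of_nonneg (dilatedBump_nonneg _ _)]
  exact dilatedBump_le_one _ _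

theorem tendsto_integral_mul_dilatedBump {X : Type*} [MeasurableSpace X] {μ : Measure X}
    {f : X → ℝ} (hf : Integrable f μ) {π : X → E} (hπ : Measurable π) :
    Tendsto (fun ρ : ℝ => ∫ x, f x * dilatedBump ρ (π x) ∂μ) atTop (𝓝 (∫ x, f x ∂μ)) := by
  refine tendsto_integral_filter_of_dominated_convergence (fun x => ‖f x‖)
    (Eventually.of_forall fun ρ => (integrable_mul_dilatedBump hf hπ _).aestronglyMeasurable)
    (Eventually.of_forall fun ρ => Eventually.of_forall fun x => ?_) hf.norm
    (Eventually.of_forall fun x => ?_)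
  · rw [norm_mul, Real.norm_of_nonneg (dilatedBump_nonneg _ _)]
    exact mul_le_of_le_one_right (norm_nonneg _) (dilatedBump_le_one _ _)
  · simpa using (tendsto_dilatedBump (π x)).const_mul (f x)

/-- Above the level `l`, `a = a^(1-p) a^p` and `1 - p < 0`. Leaving `l` free lets this replace
Hölder's inequality. -/
theorem le_add_rpow_mul_rpow {p a l : ℝ} (hp : 1 < p) (ha : 0 ≤ a) (hl : 0 < l) :
    a ≤ l + l ^ (1 - p) * a ^ p := by
  rcases le_or_gt a l with h | h
  · have := mul_nonneg (Real.rpow_pos_of_pos hl (1 - p)).le (Real.rpow_nonneg ha p)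
    linarith
  · have ha' : 0 < a := hl.trans h
    have h1 : a ^ (1 - p) ≤ l ^ (1 - p) :=
      Real.rpow_le_rpow_of_nonpos hl h.le (by linarith)
    have h2 : a ^ (1 - p) * a ^ p = a := by
      rw [← Real.rpow_add ha', sub_add_cancel, Real.rpow_one]
    have h3 := mul_le_mul_of_nonneg_right h1 (Real.rpow_nonneg ha p)
    linarith

theorem integral_mul_dilatedBump_le (μ : Measure E) [μ.IsAddHaarMeasure] {p l ρ : ℝ}
    (hp : 1 < p) (hl : 0 < l) (hρ : 0 < ρ) {f : E → ℝ} (hf : Integrable f μ)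
    (hf0 : ∀ᵐ x ∂μ, 0 ≤ f x) (hfp : Integrable (fun x => f x ^ p) μ) :
    ∫ x, f x * dilatedBump ρ x ∂μ ≤
      l * (ρ ^ Module.finrank ℝ E * ∫ x, unitBump E x ∂μ) +
        l ^ (1 - p) * ∫ x, f x ^ p ∂μ := by
  have hV : ∫ x, dilatedBump ρ x ∂μ = ρ ^ Module.finrank ℝ E * ∫ x, unitBump E x ∂μ :=
    Measure.integral_comp_inv_smul_of_nonneg μ (unitBump E) hρ.le
  have hχ : Integrable (dilatedBump ρ) μ :=
    (contDiff_dilatedBump ρ).continuous.integrable_of_hasCompactSupport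
      (hasCompactSupport_dilatedBump hρ)
  rw [← hV, ← integral_const_mul, ← integral_const_mul,
    ← integral_add (hχ.const_mul l) (hfp.const_mul _)]
  refine integral_mono_ae (integrable_mul_dilatedBump hf measurable_id ρ)
    ((hχ.const_mul l).add (hfp.const_mul _)) ?_
  filter_upwards [hf0] with x hx
  have h1 := mul_le_mul_of_nonneg_right (le_add_rpow_mul_rpow hp hx hl)
    (dilatedBump_nonneg ρ x)
  have h2 := mul_le_of_le_one_right
    (mul_nonneg (Real.rpow_pos_of_pos hl (1 - p)).le (Real.rpow_nonneg hx p))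
    (dilatedBump_le_one ρ x)
  change _ ≤ l * dilatedBump ρ x + l ^ (1 - p) * f x ^ p
  linarith

end Cutoff

/-! ### Mass balance for weak solutions. -/

namespace IsNonnegWeakSolution

variable {N : ℕ} {α p : ℝ} {u₀ : EuclideanSpace ℝ (Fin N) → ℝ}
  {u : ℝ → EuclideanSpace ℝ (Fin N) → ℝ}

theorem restrict_strip (T : ℝ) :
    (volume : Measure (ℝ × EuclideanSpace ℝ (Fin N))).restrict (Ioc 0 T ×ˢ univ) =
      (volume.restrict (Ioc 0 T)).prod volume := by
  rw [Measure.volume_eq_prod, ← Measure.prod_restrict, Measure.restrict_univ]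

/-- Passing from almost every slice to the product needs a measurable set, hence the detour through
a measurable representative of `u`. -/
theorem ae_nonneg_strip (hu : IsNonnegWeakSolution α p u₀ u) {T : ℝ} (hT : 0 < T) :
    ∀ᵐ z ∂(volume : Measure (ℝ × EuclideanSpace ℝ (Fin N))).restrict (Ioc 0 T ×ˢ univ),
      0 ≤ u z.1 z.2 := by
  have hm := (hu.integrable T hT).aestronglyMeasurable
  rw [restrict_strip] at hm ⊢
  have hg := hm.stronglyMeasurable_mk.measurable
  have hae := hm.ae_eq_mk
  have hpos : ∀ᵐ z ∂((volume.restrict (Ioc 0 T)).prod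
      (volume : Measure (EuclideanSpace ℝ (Fin N)))), 0 ≤ hm.mk _ z := by
    rw [Measure.ae_prod_iff_ae_ae (measurableSet_le measurable_const hg)]
    filter_upwards [Measure.ae_ae_of_ae_prod hae, ae_restrict_mem measurableSet_Ioc]
      with t ht htT
    filter_upwards [ht, hu.nonneg t htT.1] with x hx hx0
    rwa [← hx]
  filter_upwards [hae, hpos] with z hz hz0
  rwa [hz]

/-- The weak formulation for a test function which does not depend on time up to time `T`. -/
theorem weak_eq_stationary (hu : IsNonnegWeakSolution α p u₀ u)
    {χ : EuclideanSpace ℝ (Fin N) → ℝ} (hχ : ContDiff ℝ ∞ χ) (hχc : HasCompactSupport χ)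
    {T : ℝ} (hT : 0 < T) :
    (∫ x, u T x * χ x) - ∫ x, u₀ x * χ x =
      -(∫ z in Ioc 0 T ×ˢ (univ : Set (EuclideanSpace ℝ (Fin N))),
          u z.1 z.2 * fracLaplacian α χ z.2)
        - ∫ z in Ioc 0 T ×ˢ (univ : Set (EuclideanSpace ℝ (Fin N))),
          u z.1 z.2 ^ p * χ z.2 := by
  -- The plateau extends past `T`, so that the time derivative vanishes at `T` itself.
  let η : ContDiffBump (0 : ℝ) := ⟨T + 1, T + 2, by linarith, by linarith⟩
  have hη : ∀ t ∈ Icc 0 T, η t = 1 := fun t ht => η.one_of_mem_closedBall (by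
    rw [mem_closedBall_zero_iff, Real.norm_of_nonneg ht.1]
    exact ht.2.trans (le_add_of_nonneg_right zero_le_one))
  have hη' : ∀ t ∈ Icc 0 T, ∀ c : ℝ, deriv (fun s => η s * c) t = 0 := fun t ht c => by
    have : (fun s => η s * c) =ᶠ[𝓝 t] fun _ => 1 * c := by
      filter_upwards [η.eventuallyEq_one_of_mem_ball (x := t) (by
        rw [mem_ball_zero_iff, Real.norm_of_nonneg ht.1]
        exact ht.2.trans_lt (lt_add_of_pos_right _ one_pos))] with s hs
      rw [hs, Pi.one_apply]
    rw [this.deriv_eq, deriv_const]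
  have hφc : HasCompactSupport
      (fun z : ℝ × EuclideanSpace ℝ (Fin N) => η z.1 * χ z.2) := by
    refine HasCompactSupport.intro (η.hasCompactSupport.isCompact.prod hχc.isCompact)
      fun z hz => ?_
    rw [mem_prod, not_and_or] at hz
    rcases hz with hz | hz
    · rw [image_eq_zero_of_notMem_tsupport hz, zero_mul]
    · rw [image_eq_zero_of_notMem_tsupport hz, mul_zero]
  have hφ : ContDiff ℝ ∞ (fun z : ℝ × EuclideanSpace ℝ (Fin N) => η z.1 * χ z.2) :=
    (η.contDiff.comp contDiff_fst).mul (hχ.comp contDiff_snd)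
  have h := hu.weak_eq _ hφ hφc T hT
  simp only [hη T ⟨hT.le, le_rfl⟩, hη 0 ⟨le_rfl, hT.le⟩, one_mul] at h
  have hmeas : MeasurableSet (Ioc 0 T ×ˢ (univ : Set (EuclideanSpace ℝ (Fin N)))) :=
    measurableSet_Ioc.prod MeasurableSet.univ
  rw [h, ← integral_neg]
  congr 1
  · refine setIntegral_congr_fun hmeas fun z hz => ?_
    have hz1 : z.1 ∈ Icc 0 T := Ioc_subset_Icc_self hz.1
    simp only [hη' z.1 hz1, hη z.1 hz1, one_mul]
    ring
  · refine setIntegral_congr_fun hmeas fun z hz => ?_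
    simp only [hη z.1 (Ioc_subset_Icc_self hz.1), one_mul]

theorem exists_localized_mass_balance (hu : IsNonnegWeakSolution α p u₀ u) :
    ∃ C : ℝ, 0 ≤ C ∧ ∀ ρ : ℝ, 0 < ρ → ∀ T : ℝ, 0 < T →
      |(∫ x, u T x * dilatedBump ρ x) + (∫ z in Ioc 0 T ×ˢ univ,
          u z.1 z.2 ^ p * dilatedBump ρ z.2) - ∫ x, u₀ x * dilatedBump ρ x| ≤
        C * ρ ^ (-α) * ∫ z in Ioc 0 T ×ˢ univ, u z.1 z.2 := by
  obtain ⟨C, hC, hbound⟩ := exists_abs_fracLaplacian_comp_inv_smul_le (N := N) α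
    (unitBump (EuclideanSpace ℝ (Fin N)))
  refine ⟨C, hC, fun ρ hρ T hT => ?_⟩
  have h := hu.weak_eq_stationary (contDiff_dilatedBump ρ) (hasCompactSupport_dilatedBump hρ) hT
  have heq : (∫ x, u T x * dilatedBump ρ x) + (∫ z in Ioc 0 T ×ˢ univ,
          u z.1 z.2 ^ p * dilatedBump ρ z.2) - ∫ x, u₀ x * dilatedBump ρ x =
      -(∫ z in Ioc 0 T ×ˢ (univ : Set (EuclideanSpace ℝ (Fin N))),
          u z.1 z.2 * fracLaplacian α (dilatedBump ρ) z.2) := by linarith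
  rw [heq, abs_neg, ← integral_const_mul, ← Real.norm_eq_abs]
  refine norm_integral_le_of_norm_le ((hu.integrable T hT).const_mul _) ?_
  filter_upwards [hu.ae_nonneg_strip hT] with z hz
  rw [norm_mul, Real.norm_of_nonneg hz, mul_comm]
  exact mul_le_mul_of_nonneg_right (hbound ρ hρ z.2) hz

/-- The definition gives integrability of `u^p` only over compact sets in space; the localized
balance bounds these integrals uniformly along exhausting balls. -/
theorem integrableOn_pow_strip (hu : IsNonnegWeakSolution α p u₀ u) (hα : 0 < α)
    (hu₀ : Integrable u₀) (hu₀_nonneg : ∀ᵐ x, 0 ≤ u₀ x) {T : ℝ} (hT : 0 < T) :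
    IntegrableOn (fun z : ℝ × EuclideanSpace ℝ (Fin N) => u z.1 z.2 ^ p)
      (Ioc 0 T ×ˢ univ) := by
  obtain ⟨C, hC, hbal⟩ := hu.exists_localized_mass_balance
  have hnn := hu.ae_nonneg_strip hT
  have hnn' : 0 ≤ ∫ z in Ioc 0 T ×ˢ (univ : Set (EuclideanSpace ℝ (Fin N))), u z.1 z.2 :=
    integral_nonneg_of_ae hnn
  have hsub : ∀ r : ℝ, (Ioc 0 T ×ˢ (univ : Set (EuclideanSpace ℝ (Fin N)))) ∩
      Prod.snd ⁻¹' Metric.closedBall 0 r = Ioc 0 T ×ˢ Metric.closedBall 0 r := fun r => by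
    ext z; simp
  have hballm : ∀ r : ℝ, MeasurableSet
      (Prod.snd ⁻¹' Metric.closedBall 0 r : Set (ℝ × EuclideanSpace ℝ (Fin N))) := fun r =>
    measurable_snd Metric.isClosed_closedBall.measurableSet
  have hrestr : ∀ r : ℝ, ((volume : Measure (ℝ × EuclideanSpace ℝ (Fin N))).restrict
      (Ioc 0 T ×ˢ univ)).restrict (Prod.snd ⁻¹' Metric.closedBall 0 r) =
        volume.restrict (Ioc 0 T ×ˢ Metric.closedBall 0 r) := fun r => by
    rw [Measure.restrict_restrict (hballm r), inter_comm, hsub]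
  have hcov : AECover ((volume : Measure (ℝ × EuclideanSpace ℝ (Fin N))).restrict
      (Ioc 0 T ×ˢ univ)) atTop
      -- Radii at least `1` keep `ρ^(-α) ≤ 1`.
      (fun n : ℕ => Prod.snd ⁻¹' Metric.closedBall 0 ((n : ℝ) + 1)) := by
    refine ⟨Eventually.of_forall fun z => ?_, fun n => hballm _⟩
    obtain ⟨m, hm⟩ := exists_nat_ge ‖z.2‖
    filter_upwards [eventually_ge_atTop m] with n hn
    have : (m : ℝ) ≤ n := by exact_mod_cast hn
    rw [mem_preimage, mem_closedBall_zero_iff]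
    linarith
  have hloc : ∀ r : ℝ, IntegrableOn (fun z : ℝ × EuclideanSpace ℝ (Fin N) => u z.1 z.2 ^ p)
      (Ioc 0 T ×ˢ Metric.closedBall 0 r) := fun r =>
    hu.integrable_pow T hT _ (isCompact_closedBall _ _)
  refine hcov.integrable_of_integral_bounded_of_nonneg_ae
    ((∫ x, u₀ x) + C * ∫ z in Ioc 0 T ×ˢ (univ : Set (EuclideanSpace ℝ (Fin N))), u z.1 z.2)
    (fun n => ?_) ?_ (Eventually.of_forall fun n => ?_)
  · rw [IntegrableOn, hrestr]
    exact hloc _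
  · filter_upwards [hnn] with z hz using Real.rpow_nonneg hz p
  · have hn : (0 : ℝ) < n + 1 := by positivity
    rw [hrestr]
    have hb := (abs_le.1 (hbal _ hn T hT)).2
    have hle1 : ((n : ℝ) + 1) ^ (-α) ≤ 1 :=
      Real.rpow_le_one_of_one_le_of_nonpos (by linarith [n.cast_nonneg (α := ℝ)])
        (neg_nonpos.2 hα.le)
    have h0 : ∫ x, u₀ x * dilatedBump ((n : ℝ) + 1) x ≤ ∫ x, u₀ x := by
      refine integral_mono_ae (integrable_mul_dilatedBump hu₀ measurable_id _) hu₀ ?_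
      filter_upwards [hu₀_nonneg] with x hx
      exact mul_le_of_le_one_right hx (dilatedBump_le_one _ _)
    have h1 : 0 ≤ ∫ x, u T x * dilatedBump ((n : ℝ) + 1) x := by
      refine integral_nonneg_of_ae ?_
      filter_upwards [hu.nonneg T hT] with x hx
      exact mul_nonneg hx (dilatedBump_nonneg _ _)
    have hzero : ∀ z : ℝ × EuclideanSpace ℝ (Fin N),
        z ∈ (Ioc 0 T ×ˢ univ) \ (Ioc 0 T ×ˢ Metric.closedBall 0 (2 * ((n : ℝ) + 1))) →
        u z.1 z.2 ^ p * dilatedBump ((n : ℝ) + 1) z.2 = 0 := by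
      rintro z ⟨hz, hz'⟩
      rw [dilatedBump_eq_zero hn, mul_zero]
      by_contra! hlt
      exact hz' ⟨hz.1, mem_closedBall_zero_iff.2 hlt.le⟩
    have h2 : ∫ z in Ioc 0 T ×ˢ Metric.closedBall 0 ((n : ℝ) + 1), u z.1 z.2 ^ p ≤
        ∫ z in Ioc 0 T ×ˢ univ, u z.1 z.2 ^ p * dilatedBump ((n : ℝ) + 1) z.2 := by
      -- Monotonicity of the integral needs integrability on the larger set, known so far only on
      -- bounded balls; hence the cut to radius `2ρ`.
      rw [setIntegral_eq_of_subset_of_forall_sdiff_eq_zero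
        (measurableSet_Ioc.prod MeasurableSet.univ)
        (prod_mono_right (subset_univ (Metric.closedBall 0 (2 * ((n : ℝ) + 1))))) hzero]
      have hm : MeasurableSet (Ioc 0 T ×ˢ Metric.closedBall
          (0 : EuclideanSpace ℝ (Fin N)) ((n : ℝ) + 1)) :=
        measurableSet_Ioc.prod Metric.isClosed_closedBall.measurableSet
      calc ∫ z in Ioc 0 T ×ˢ Metric.closedBall 0 ((n : ℝ) + 1), u z.1 z.2 ^ p
          = ∫ z in Ioc 0 T ×ˢ Metric.closedBall 0 ((n : ℝ) + 1),
              u z.1 z.2 ^ p * dilatedBump ((n : ℝ) + 1) z.2 := by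
            refine setIntegral_congr_fun hm fun z hz => ?_
            simp only [dilatedBump_eq_one hn (mem_closedBall_zero_iff.1 hz.2), mul_one]
        _ ≤ _ := by
            refine setIntegral_mono_set
              (integrable_mul_dilatedBump (hloc _) measurable_snd _) ?_
              (LE.le.eventuallyLE (prod_mono_right
                (Metric.closedBall_subset_closedBall (by linarith))))
            filter_upwards [ae_restrict_of_ae_restrict_of_subset
              (prod_mono_right (subset_univ _)) hnn] with z hz
            exact mul_nonneg (Real.rpow_nonneg hz p) (dilatedBump_nonneg _ _)
    have h3 := mul_le_mul_of_nonneg_right (mul_le_of_le_one_right hC hle1) hnn'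
    linarith

/-- Mass balance: the mass lost up to time `T` is the integral of the absorption term. -/
theorem mass_balance (hu : IsNonnegWeakSolution α p u₀ u) (hα : 0 < α)
    (hu₀ : Integrable u₀) (hu₀_nonneg : ∀ᵐ x, 0 ≤ u₀ x) {T : ℝ} (hT : 0 < T) :
    (∫ x, u T x) + ∫ z in Ioc 0 T ×ˢ (univ : Set (EuclideanSpace ℝ (Fin N))),
      u z.1 z.2 ^ p = ∫ x, u₀ x := by
  obtain ⟨C, hC, hbal⟩ := hu.exists_localized_mass_balance
  have h1 := ((tendsto_integral_mul_dilatedBump (hu.integrable_slice T hT) measurable_id).add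
    (tendsto_integral_mul_dilatedBump
      (hu.integrableOn_pow_strip hα hu₀ hu₀_nonneg hT) measurable_snd)).sub
    (tendsto_integral_mul_dilatedBump hu₀ measurable_id)
  have h2 : Tendsto (fun ρ : ℝ => C * ρ ^ (-α) *
      ∫ z in Ioc 0 T ×ˢ (univ : Set (EuclideanSpace ℝ (Fin N))), u z.1 z.2) atTop (𝓝 0) := by
    simpa using ((tendsto_rpow_neg_atTop hα).const_mul C).mul_const
      (∫ z in Ioc 0 T ×ˢ (univ : Set (EuclideanSpace ℝ (Fin N))), u z.1 z.2)
  refine sub_eq_zero.1 (tendsto_nhds_unique h1 (squeeze_zero_norm' ?_ h2))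
  filter_upwards [eventually_gt_atTop 0] with ρ hρ using hbal ρ hρ T hT

theorem mass_le (hu : IsNonnegWeakSolution α p u₀ u) (hα : 0 < α)
    (hu₀ : Integrable u₀) (hu₀_nonneg : ∀ᵐ x, 0 ≤ u₀ x) {T : ℝ} (hT : 0 < T) :
    ∫ x, u T x ≤ ∫ x, u₀ x := by
  have hnn : 0 ≤ ∫ z in Ioc 0 T ×ˢ (univ : Set (EuclideanSpace ℝ (Fin N))), u z.1 z.2 ^ p :=
    integral_nonneg_of_ae (by
      filter_upwards [hu.ae_nonneg_strip hT] with z hz using Real.rpow_nonneg hz p)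
  linarith [hu.mass_balance hα hu₀ hu₀_nonneg hT]

theorem mass_antitoneOn (hu : IsNonnegWeakSolution α p u₀ u) (hα : 0 < α)
    (hu₀ : Integrable u₀) (hu₀_nonneg : ∀ᵐ x, 0 ≤ u₀ x) :
    AntitoneOn (fun t : ℝ => ∫ x, u t x) (Ioi 0) := by
  intro s hs t ht hst
  have hmono : ∫ z in Ioc 0 s ×ˢ (univ : Set (EuclideanSpace ℝ (Fin N))), u z.1 z.2 ^ p ≤
      ∫ z in Ioc 0 t ×ˢ (univ : Set (EuclideanSpace ℝ (Fin N))), u z.1 z.2 ^ p := by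
    refine setIntegral_mono_set (hu.integrableOn_pow_strip hα hu₀ hu₀_nonneg ht) ?_
      (LE.le.eventuallyLE (prod_mono_left (Ioc_subset_Ioc_right hst)))
    filter_upwards [hu.ae_nonneg_strip ht] with z hz using Real.rpow_nonneg hz p
  have h1 := hu.mass_balance hα hu₀ hu₀_nonneg hs
  have h2 := hu.mass_balance hα hu₀ hu₀_nonneg ht
  change ∫ x, u t x ≤ ∫ x, u s x
  linarith

theorem integral_strip_le (hu : IsNonnegWeakSolution α p u₀ u) (hα : 0 < α)
    (hu₀ : Integrable u₀) (hu₀_nonneg : ∀ᵐ x, 0 ≤ u₀ x) {T : ℝ} (hT : 0 < T) :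
    ∫ z in Ioc 0 T ×ˢ (univ : Set (EuclideanSpace ℝ (Fin N))), u z.1 z.2 ≤
      T * ∫ x, u₀ x := by
  have hint := hu.integrable T hT
  rw [IntegrableOn, restrict_strip] at hint
  rw [restrict_strip, integral_prod _ hint]
  calc ∫ t in Ioc 0 T, ∫ x, u t x ≤ ∫ _ in Ioc 0 T, ∫ x, u₀ x :=
        setIntegral_mono_on hint.integral_prod_left (integrable_const _) measurableSet_Ioc
          fun t ht => hu.mass_le hα hu₀ hu₀_nonneg ht.1
    _ = T * ∫ x, u₀ x := by simp [hT.le]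

/-! ### Lower bound on the absorption, and decay. -/

/-- Almost all the mass at time `T` sits in a ball of radius comparable to `T ^ (1 / α)`. -/
theorem exists_mass_le_localized (hu : IsNonnegWeakSolution α p u₀ u) (hα : 0 < α)
    (hu₀ : Integrable u₀) (hu₀_nonneg : ∀ᵐ x, 0 ≤ u₀ x) :
    ∃ C : ℝ, 0 ≤ C ∧ ∀ ρ : ℝ, 0 < ρ → ∀ T : ℝ, 0 < T →
      ∫ x, u T x ≤ (∫ x, u T x * dilatedBump ρ x) +
        ((∫ x, u₀ x) - ∫ x, u₀ x * dilatedBump ρ x) + C * (T * ρ ^ (-α)) := by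
  obtain ⟨C, hC, hbal⟩ := hu.exists_localized_mass_balance
  have hM : 0 ≤ ∫ x, u₀ x := integral_nonneg_of_ae hu₀_nonneg
  refine ⟨C * ∫ x, u₀ x, mul_nonneg hC hM, fun ρ hρ T hT => ?_⟩
  have hb := (abs_le.1 (hbal ρ hρ T hT)).1
  have hpow := hu.integrableOn_pow_strip hα hu₀ hu₀_nonneg hT
  have h1 : ∫ z in Ioc 0 T ×ˢ (univ : Set (EuclideanSpace ℝ (Fin N))),
      u z.1 z.2 ^ p * dilatedBump ρ z.2 ≤
      ∫ z in Ioc 0 T ×ˢ (univ : Set (EuclideanSpace ℝ (Fin N))), u z.1 z.2 ^ p := by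
    refine integral_mono_ae (integrable_mul_dilatedBump hpow measurable_snd ρ) hpow ?_
    filter_upwards [hu.ae_nonneg_strip hT] with z hz
    exact mul_le_of_le_one_right (Real.rpow_nonneg hz p) (dilatedBump_le_one _ _)
  have h2 := mul_le_mul_of_nonneg_left (hu.integral_strip_le hα hu₀ hu₀_nonneg hT)
    (mul_nonneg hC (Real.rpow_pos_of_pos hρ (-α)).le)
  have h3 := hu.mass_balance hα hu₀ hu₀_nonneg hT
  have h4 : C * ρ ^ (-α) * (T * ∫ x, u₀ x) = C * (∫ x, u₀ x) * (T * ρ ^ (-α)) := by ring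
  linarith

/-- If the mass stays above `ε`, it stays above `ε / 2` on balls of radius `B * t ^ (1 / α)`. -/
theorem exists_localized_mass_ge (hu : IsNonnegWeakSolution α p u₀ u) (hα : 0 < α)
    (hu₀ : Integrable u₀) (hu₀_nonneg : ∀ᵐ x, 0 ≤ u₀ x) {ε : ℝ} (hε : 0 < ε)
    (hmass : ∀ t : ℝ, 0 < t → ε ≤ ∫ x, u t x) :
    ∃ B : ℝ, 0 < B ∧ ∀ᶠ t : ℝ in atTop,
      ε / 2 ≤ ∫ x, u t x * dilatedBump (B * t ^ (1 / α)) x := by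
  obtain ⟨C, hC, hloc⟩ := hu.exists_mass_le_localized hα hu₀ hu₀_nonneg
  have hBlim : Tendsto (fun B : ℝ => C * B ^ (-α)) atTop (𝓝 0) := by
    simpa using (tendsto_rpow_neg_atTop hα).const_mul C
  -- Of `ε`, one quarter pays for the spreading error and one for the tail of `u₀`.
  obtain ⟨B, hBε, hB⟩ :=
    ((hBlim.eventually_lt_const (show 0 < ε / 4 by positivity)).and
      (eventually_gt_atTop 0)).exists
  refine ⟨B, hB, ?_⟩
  have hradius : Tendsto (fun t : ℝ => B * t ^ (1 / α)) atTop atTop :=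
    (tendsto_rpow_atTop (by positivity)).const_mul_atTop hB
  have htail := ((tendsto_integral_mul_dilatedBump hu₀ measurable_id).comp
    hradius).eventually_const_lt (show (∫ x, u₀ x) - ε / 4 < ∫ x, u₀ x by linarith)
  filter_upwards [htail, eventually_gt_atTop 0] with t ht ht0
  have hr : 0 < t ^ (1 / α) := Real.rpow_pos_of_pos ht0 _
  have hscale : t * (B * t ^ (1 / α)) ^ (-α) = B ^ (-α) := by
    rw [Real.mul_rpow hB.le hr.le, ← Real.rpow_mul ht0.le, one_div, mul_neg,
      inv_mul_cancel₀ hα.ne', Real.rpow_neg_one]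
    field_simp
  have h := hloc (B * t ^ (1 / α)) (by positivity) t ht0
  rw [hscale] at h
  have ht' : (∫ x, u₀ x) - ε / 4 < ∫ x, u₀ x * dilatedBump (B * t ^ (1 / α)) x := ht
  linarith [hmass t ht0]

/-- If the mass does not decay, the absorption rate at time `t` is at least of order `1 / t`. -/
theorem exists_absorption_ge (hu : IsNonnegWeakSolution α p u₀ u) (hN : 1 ≤ N) (hα : 0 < α)
    (hp : 1 < p) (hp' : p ≤ 1 + α / N)
    (hu₀ : Integrable u₀) (hu₀_nonneg : ∀ᵐ x, 0 ≤ u₀ x) {ε : ℝ} (hε : 0 < ε)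
    (hmass : ∀ t : ℝ, 0 < t → ε ≤ ∫ x, u t x) :
    ∃ c : ℝ, 0 < c ∧ ∀ᶠ t : ℝ in atTop,
      Integrable (fun x => u t x ^ p) → c * t⁻¹ ≤ ∫ x, u t x ^ p := by
  obtain ⟨B, hB, hev⟩ := hu.exists_localized_mass_ge hα hu₀ hu₀_nonneg hε hmass
  set V : ℝ := ∫ x, unitBump (EuclideanSpace ℝ (Fin N)) x with hVdef
  have hV : 0 ≤ V := integral_nonneg fun _ => (unitBump _).nonneg
  -- Chosen so that values below `l = κ t^(-N/α)` carry mass at most `ε/4`, half of what is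
  -- localized; `V + 1` avoids proving `V > 0`.
  set κ : ℝ := ε / (4 * (V + 1) * B ^ N) with hκdef
  have hκ : 0 < κ := by positivity
  refine ⟨ε / 4 * κ ^ (p - 1), by positivity, ?_⟩
  filter_upwards [hev, eventually_ge_atTop 1] with t ht ht1 hint
  have ht0 : 0 < t := one_pos.trans_le ht1
  have hr : 0 < t ^ (1 / α) := Real.rpow_pos_of_pos ht0 _
  set l : ℝ := κ / (t ^ (1 / α)) ^ N with hldef
  have hl : 0 < l := by positivity
  have hmain := integral_mul_dilatedBump_le volume hp hl
    (show 0 < B * t ^ (1 / α) by positivity) (hu.integrable_slice t ht0) (hu.nonneg t ht0) hint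
  rw [finrank_euclideanSpace_fin, ← hVdef] at hmain
  have hvol : l * ((B * t ^ (1 / α)) ^ N * V) ≤ ε / 4 := by
    have : l * ((B * t ^ (1 / α)) ^ N * V) = ε / 4 * (V / (V + 1)) := by
      rw [hldef, hκdef, mul_pow]
      field_simp
    rw [this]
    exact mul_le_of_le_one_right (by positivity) ((div_le_one (by positivity)).2 (by linarith))
  have hlower : ε / 4 * l ^ (p - 1) ≤ ∫ x, u t x ^ p := by
    have h1 : l ^ (p - 1) * l ^ (1 - p) = 1 := by
      rw [← Real.rpow_add hl, sub_add_sub_cancel, sub_self, Real.rpow_zero]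
    have h2 : ε / 4 ≤ l ^ (1 - p) * ∫ x, u t x ^ p := by linarith
    calc ε / 4 * l ^ (p - 1) ≤ (l ^ (1 - p) * ∫ x, u t x ^ p) * l ^ (p - 1) :=
          mul_le_mul_of_nonneg_right h2 (by positivity)
      _ = (l ^ (p - 1) * l ^ (1 - p)) * ∫ x, u t x ^ p := by ring
      _ = ∫ x, u t x ^ p := by rw [h1, one_mul]
  refine le_trans ?_ hlower
  rw [mul_assoc]
  refine mul_le_mul_of_nonneg_left ?_ (by positivity)
  rw [hldef, Real.div_rpow hκ.le (by positivity), div_eq_mul_inv]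
  refine mul_le_mul_of_nonneg_left (inv_anti₀ (by positivity) ?_) (by positivity)
  have hN' : (0 : ℝ) < N := by exact_mod_cast hN
  -- The condition `p ≤ 1 + α / N` enters here; `t ≥ 1` then turns it into `t^(N(p-1)/α) ≤ t`.
  have hexp : 1 / α * N * (p - 1) ≤ 1 := by
    have h1 : p - 1 ≤ α / N := by linarith
    calc 1 / α * N * (p - 1) ≤ 1 / α * N * (α / N) :=
          mul_le_mul_of_nonneg_left h1 (by positivity)
      _ = 1 := by field_simp
  rw [← Real.rpow_natCast, ← Real.rpow_mul ht0.le, ← Real.rpow_mul ht0.le]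
  simpa using Real.rpow_le_rpow_of_exponent_le ht1 hexp

/-- In the range `p ≤ 1 + α / N` the mass cannot stay bounded away from zero. -/
theorem exists_mass_lt (hu : IsNonnegWeakSolution α p u₀ u) (hN : 1 ≤ N) (hα : 0 < α)
    (hp : 1 < p) (hp' : p ≤ 1 + α / N)
    (hu₀ : Integrable u₀) (hu₀_nonneg : ∀ᵐ x, 0 ≤ u₀ x) {ε : ℝ} (hε : 0 < ε) :
    ∃ t : ℝ, 0 < t ∧ ∫ x, u t x < ε := by
  by_contra! hmass
  obtain ⟨c, hc, hev⟩ := hu.exists_absorption_ge hN hα hp hp' hu₀ hu₀_nonneg hε hmass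
  obtain ⟨s, hs⟩ := eventually_atTop.1 (hev.and (eventually_ge_atTop 1))
  have hs0 : 0 < s := one_pos.trans_le (hs s le_rfl).2
  have hM : 0 ≤ ∫ x, u₀ x := integral_nonneg_of_ae hu₀_nonneg
  have hbound : ∀ T : ℝ, s ≤ T → c * Real.log (T / s) ≤ ∫ x, u₀ x := by
    intro T hT
    have hT0 : 0 < T := hs0.trans_le hT
    have hint := hu.integrableOn_pow_strip hα hu₀ hu₀_nonneg hT0
    have hbal := hu.mass_balance hα hu₀ hu₀_nonneg hT0
    rw [IntegrableOn, restrict_strip] at hint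
    rw [restrict_strip, integral_prod _ hint] at hbal
    have hsub : Ioc s T ⊆ Ioc 0 T := Ioc_subset_Ioc_left hs0.le
    have hnn : 0 ≤ᵐ[volume.restrict (Ioc 0 T)] fun t => ∫ x, u t x ^ p := by
      filter_upwards [ae_restrict_mem measurableSet_Ioc] with t ht
      refine integral_nonneg_of_ae ?_
      filter_upwards [hu.nonneg t ht.1] with x hx using Real.rpow_nonneg hx p
    have hinv : IntervalIntegrable (fun t : ℝ => c * t⁻¹) volume s T :=
      (intervalIntegrable_inv_iff.2
        (Or.inr (notMem_uIcc_of_lt hs0 hT0))).const_mul c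
    calc c * Real.log (T / s) = ∫ t in Ioc s T, c * t⁻¹ := by
          rw [← intervalIntegral.integral_of_le hT, intervalIntegral.integral_const_mul,
            integral_inv_of_pos hs0 hT0]
      _ ≤ ∫ t in Ioc s T, ∫ x, u t x ^ p := by
          refine integral_mono_ae hinv.1
            (IntegrableOn.mono_set (t := Ioc 0 T) hint.integral_prod_left hsub) ?_
          -- Fubini makes `u(t)^p` integrable only for almost every `t`, which suffices here.
          filter_upwards [ae_restrict_mem measurableSet_Ioc,
            ae_restrict_of_ae_restrict_of_subset hsub hint.prod_right_ae] with t ht hti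
          exact (hs t ht.1.le).1 hti
      _ ≤ ∫ t in Ioc 0 T, ∫ x, u t x ^ p :=
          setIntegral_mono_set hint.integral_prod_left hnn hsub.eventuallyLE
      _ ≤ ∫ x, u₀ x := by linarith [hmass T hT0]
  -- With this `T` the left side of the bound is `∫ u₀ + 1`.
  have h := hbound (s * Real.exp (((∫ x, u₀ x) + 1) / c))
    (le_mul_of_one_le_right hs0.le (Real.one_le_exp (by positivity)))
  rw [mul_div_cancel_left₀ _ hs0.ne', Real.log_exp, mul_div_cancel₀ _ hc.ne'] at h
  linarith

end IsNonnegWeakSolution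

theorem theorem2 (N : ℕ) (hN : 1 ≤ N) (α : ℝ) (hα : 0 < α) (hα2 : α ≤ 2)
    (p : ℝ) (hp : 1 < p) (hp' : p ≤ 1 + α / N)
    (u₀ : EuclideanSpace ℝ (Fin N) → ℝ) (hu₀ : Integrable u₀) (hu₀_nonneg : ∀ᵐ x, 0 ≤ u₀ x)
    (u : ℝ → EuclideanSpace ℝ (Fin N) → ℝ) (hu : IsNonnegWeakSolution α p u₀ u) :
    Tendsto (fun t : ℝ => ∫ x, u t x) atTop (𝓝 0) := by
  rw [Metric.tendsto_atTop]
  intro ε hε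
  obtain ⟨s, hs, hsε⟩ := hu.exists_mass_lt hN hα hp hp' hu₀ hu₀_nonneg hε
  refine ⟨s, fun t ht => ?_⟩
  have ht0 : 0 < t := hs.trans_le ht
  rw [dist_zero_right, Real.norm_of_nonneg (integral_nonneg_of_ae (hu.nonneg t ht0))]
  exact (hu.mass_antitoneOn hα hu₀ hu₀_nonneg hs ht0 ht).trans_lt hsε
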